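/- Let $d\ge 2$, $a\ge 1$ and $m:=2^d a$. Let $p,\ell$ be (not necessarily distinct) odd primes and let $q$ be a power of $p$. Let $\mathrm{SO}_m^+(p)\le \mathrm{GL}_m(p)\le \mathrm{GL}_m(q)$ be the group of determinant-one isometries of a hyperbolic (plus type) symmetric bilinear form on $\mathbb{F}_p^m$, and let $G\le \mathrm{GL}_m(q)$ be a subgroup that contains $\mathrm{SO}_m^+(p)$ (or a $\mathrm{GL}_m(q)$-conjugate of it). Let $\chi$ be a faithful irreducible ordinary character or a faithful irreducible $\ell$-Brauer character of $G$. Then: (a) $2^d$ divides $\chi(1)$. (b) If the indicator of $\chi$ is $+$ (i.e. $\chi$ is afforded by a real representation, respectively, in the Brauer case, $\chi$ is afforded by a representation over an algebraically closed field of characteristic $\ell$ that fixes a non-degenerate quadratic form), then the orthogonal discriminant of $\chi$ is $1$. (c) If $\chi$ is an ordinary character of indicator 'o' (i.e. its character field is not real), then the unitary discriminant of $\chi$ is $1$. Here the discriminant of a non-degenerate symmetric or Hermitian form $H$ with Gram matrix $S$ of size $n$ over a field $L$, with respect to an automorphism $\sigma$ of $L$ with $\sigma^2=\mathrm{id}$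 ($\sigma=\mathrm{id}$ in the symmetric case), is the class $\operatorname{disc}(H)=(-1)^{\binom n2}\det(S)\,N$, where $N=\{x\,\sigma(x) : x\in L^\times\}$. Let $E$ be the character field of $\chi$ (in the Brauer case: the finite field generated by the traces of a representation in characteristic $\ell$ affording $\chi$). The orthogonal discriminant of $\chi$ is the class $c\,(E^\times)^2\in E^\times/(E^\times)^2$ such that for every field $L\supseteq E$, every representation $\rho:G\to\mathrm{GL}_n(L)$ affording $\chi$ and every non-degenerate $\rho(G)$-invariant symmetric bilinear form $H$ one has $\operatorname{disc}(H)=c\,(L^\times)^2$. If $E$ is not real and $K=E\cap\mathbb{R}$, the unitary discriminant of $\chi$ is the class $c\,N_{E/K}(E^\times)\in K^\times/N_{E/K}(E^\times)$ such that for every field $M\supseteq E$ with an automorphism $\sigma$ of order $2$ extending complex conjugation on $E$, with fixed field $M^+$, every representation $\rho:G\to\mathrm{GL}_n(M)$ affording $\chi$ and every non-degenerate $\rho(G)$-invariant Hermitian form $H$ over $M/M^+$ one has $\operatorname{disc}(H)=c\,N_{M/M^+}(M^\times)$. That a discriminant is $1$ means that $c=1$ has this property. -/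

import Mathlib

open scoped MatrixGroups ComplexConjugate

namespace FaithfulDisc

/-! ### The group `SO_m^+` -/

/-- The Gram matrix (ones on the antidiagonal) of the split symmetric bilinear form
`(v, w) ↦ ∑ i, v i * w (m - 1 - i)`. For even `m` this is an orthogonal sum of `m / 2` hyperbolic
planes, that is, the form of plus type. -/
def splitForm (m : ℕ) (R : Type*) [CommRing R] : Matrix (Fin m) (Fin m) R :=
  Matrix.of fun i j => if j = Fin.rev i then 1 else 0

/-- `SO_m^+(R)` (for even `m`): the matrices of determinant `1` preserving the split form. -/
def SOPlus (m : ℕ) (R : Type*) [CommRing R] : Subgroup (GL (Fin m) R) where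
  carrier := {A | (A : Matrix (Fin m) (Fin m) R).transpose * splitForm m R * A = splitForm m R ∧
    (A : Matrix (Fin m) (Fin m) R).det = 1}
  one_mem' := by simp
  mul_mem' := by
    rintro A B ⟨hA, hA'⟩ ⟨hB, hB'⟩
    refine ⟨?_, by simp [hA', hB']⟩
    calc _ = (B : Matrix (Fin m) (Fin m) R).transpose *
          ((A : Matrix (Fin m) (Fin m) R).transpose * splitForm m R * A) * B := by
            simp [Matrix.mul_assoc]
      _ = _ := by rw [hA, hB]
  inv_mem' := by
    rintro A ⟨hA, hA'⟩
    have h1 : (A : Matrix (Fin m) (Fin m) R) * (A⁻¹ : GL (Fin m) R) = 1 := by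
      rw [← Units.val_mul, mul_inv_cancel, Units.val_one]
    have h2 : ((A⁻¹ : GL (Fin m) R) : Matrix (Fin m) (Fin m) R).transpose *
        (A : Matrix (Fin m) (Fin m) R).transpose = 1 := by
      rw [← Matrix.transpose_mul, h1, Matrix.transpose_one]
    refine ⟨?_, ?_⟩
    · calc _ = ((A⁻¹ : GL (Fin m) R) : Matrix (Fin m) (Fin m) R).transpose *
            ((A : Matrix (Fin m) (Fin m) R).transpose * splitForm m R * A) *
            (A⁻¹ : GL (Fin m) R) := by rw [hA]
        _ = (((A⁻¹ : GL (Fin m) R) : Matrix (Fin m) (Fin m) R).transpose *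
            (A : Matrix (Fin m) (Fin m) R).transpose) * splitForm m R *
            ((A : Matrix (Fin m) (Fin m) R) * (A⁻¹ : GL (Fin m) R)) := by
              simp only [Matrix.mul_assoc]
        _ = _ := by rw [h1, h2, Matrix.one_mul, Matrix.mul_one]
    · have := congrArg Matrix.det h1
      rwa [Matrix.det_mul, hA', one_mul, Matrix.det_one] at this

/-! ### Matrix representations, invariant Hermitian forms and their discriminants -/

section

variable {G : Type*} [Group G]

/-- The trace character of a matrix representation. -/
def traceChar {L : Type*} [Field L] {n : ℕ} (ρ : G →* GL (Fin n) L) (g : G) : L :=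
  (ρ g : Matrix (Fin n) (Fin n) L).trace

/-- The linear representation on column vectors given by a matrix representation. -/
def toRepresentation {L : Type*} [Field L] {n : ℕ} (ρ : G →* GL (Fin n) L) :
    Representation L G (Fin n → L) :=
  (Matrix.toLinAlgEquiv' (R := L) (n := Fin n)).toAlgHom.toMonoidHom.comp
    ((Units.coeHom (Matrix (Fin n) (Fin n) L)).comp ρ)

/-- `S` is the Gram matrix of a non-degenerate `ρ(G)`-invariant Hermitian form
`H(v, w) = vᵀ S σ(w)` with respect to the field automorphism `σ`, which is meant to satisfy
`σ² = 1`. For `σ = id` these are the invariant non-degenerate symmetric bilinear forms. -/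
structure IsInvariantForm {L : Type*} [Field L] {n : ℕ} (σ : L →+* L) (ρ : G →* GL (Fin n) L)
    (S : Matrix (Fin n) (Fin n) L) : Prop where
  hermitian : ∀ i j, S i j = σ (S j i)
  nondegenerate : S.det ≠ 0
  invariant : ∀ g, (ρ g : Matrix (Fin n) (Fin n) L).transpose * S *
    (ρ g : Matrix (Fin n) (Fin n) L).map σ = S

/-- The discriminant `(-1)^(n choose 2) det S` of the form with Gram matrix `S` lies in the class
`c N`, where `N = {x σ(x) | x ≠ 0}` is the norm group (the group of squares if `σ = id`). -/
def DiscEq {L : Type*} [Field L] {n : ℕ} (σ : L →+* L) (S : Matrix (Fin n) (Fin n) L) (c : L) :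
    Prop :=
  ∃ x : L, x ≠ 0 ∧ (-1) ^ (n.choose 2) * S.det = c * (x * σ x)

/-! ### Ordinary characters -/

/-- `χ` is the character of a faithful irreducible complex representation. -/
def IsFaithfulIrreducibleCharacter (χ : G → ℂ) : Prop :=
  ∃ (n : ℕ) (ρ : G →* GL (Fin n) ℂ), (toRepresentation ρ).IsIrreducible ∧
    Function.Injective ρ ∧ traceChar ρ = χ

/-- The character field `ℚ(χ)`. -/
noncomputable def characterField (χ : G → ℂ) : Subfield ℂ := Subfield.closure (Set.range χ)

/-- Indicator `+`: there is a real representation affording `χ`. -/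
def HasIndicatorPlus (χ : G → ℂ) : Prop :=
  ∃ (n : ℕ) (ρ : G →* GL (Fin n) ℝ), ∀ g, ((traceChar ρ g : ℝ) : ℂ) = χ g

/-- Indicator 'o': the character field is not real. -/
def HasIndicatorO (χ : G → ℂ) : Prop :=
  ∃ z ∈ characterField χ, conj z ≠ z

/-- The class of `c` in `K^× / (K^×)²`, `K = ℚ(χ)`, is the orthogonal discriminant of `χ`: for
every field `L` (embedded into `ℂ` by `ι`), every representation `ρ : G → GL_n(L)` affording `χ`
and every non-degenerate `ρ(G)`-invariant symmetric bilinear form, the discriminant of the form is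
`c (L^×)²`. Note that `ι(L)` contains `K` whenever such a `ρ` exists. -/
def IsOrthogonalDiscriminant (χ : G → ℂ) (c : ℂ) : Prop :=
  c ∈ characterField χ ∧ c ≠ 0 ∧
  ∀ (L : Type) [Field L] (ι : L →+* ℂ) (n : ℕ) (ρ : G →* GL (Fin n) L),
    (∀ g, ι (traceChar ρ g) = χ g) →
    ∀ S : Matrix (Fin n) (Fin n) L, IsInvariantForm (RingHom.id L) ρ S →
      ∃ c' : L, ι c' = c ∧ DiscEq (RingHom.id L) S c'

/-- Let `E = ℚ(χ)` be non-real, with real subfield `K`. The class of `c` in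
`K^× / N_{E/K}(E^×)` is the unitary discriminant of `χ`: for every field `M` (embedded into `ℂ` by
`ι`) with an automorphism `σ` of order two extending complex conjugation on `E`, every
representation `ρ : G → GL_n(M)` affording `χ`, and every non-degenerate `ρ(G)`-invariant Hermitian
form over `M` with respect to `σ`, the discriminant of the form is `c N_{M/M⁺}(M^×)`, with `M⁺` the
fixed field of `σ`. -/
def IsUnitaryDiscriminant (χ : G → ℂ) (c : ℂ) : Prop :=
  c ∈ characterField χ ∧ conj c = c ∧ c ≠ 0 ∧
  ∀ (M : Type) [Field M] (ι : M →+* ℂ) (σ : M →+* M), (∀ x, σ (σ x) = x) →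
    (∀ x, ι x ∈ characterField χ → ι (σ x) = conj (ι x)) →
    ∀ (n : ℕ) (ρ : G →* GL (Fin n) M), (∀ g, ι (traceChar ρ g) = χ g) →
    ∀ S : Matrix (Fin n) (Fin n) M, IsInvariantForm σ ρ S →
      ∃ c' : M, ι c' = c ∧ DiscEq σ S c'

/-! ### Brauer characters -/

/-- `θ` lifts the roots of unity of `k` faithfully to complex roots of unity. -/
def IsRootOfUnityLift {k : Type*} [Field k] (θ : k →*₀ ℂ) : Prop :=
  ∀ (x : k) (n : ℕ), n ≠ 0 → x ^ n = 1 → θ x = 1 → x = 1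

/-- The `ℓ`-regular elements of `G`. -/
abbrev LRegular (G : Type*) [Group G] (ℓ : ℕ) : Type _ := {g : G // (orderOf g).Coprime ℓ}

/-- The identity as an `ℓ`-regular element. -/
def LRegular.id (G : Type*) [Group G] (ℓ : ℕ) : LRegular G ℓ := ⟨1, by simp⟩

/-- The Brauer character of a representation over an algebraically closed field `k` of
characteristic `ℓ`: the sum of the lifted eigenvalues, on the `ℓ`-regular elements. -/
noncomputable def brauerCharacter {k : Type*} [Field k] (ℓ : ℕ) (θ : k →*₀ ℂ) {n : ℕ}
    (ρ : G →* GL (Fin n) k) (g : LRegular G ℓ) : ℂ :=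
  ((ρ g.1 : Matrix (Fin n) (Fin n) k).charpoly.roots.map θ).sum

/-- `φ` is the Brauer character of a faithful irreducible representation over `k`. -/
def IsFaithfulIrreducibleBrauerCharacter {k : Type*} [Field k] (ℓ : ℕ) (θ : k →*₀ ℂ)
    (φ : LRegular G ℓ → ℂ) : Prop :=
  ∃ (n : ℕ) (ρ : G →* GL (Fin n) k), (toRepresentation ρ).IsIrreducible ∧
    Function.Injective ρ ∧ brauerCharacter ℓ θ ρ = φ

/-- Indicator `+` (in odd characteristic): a representation over the algebraically closed field `k`
affording `φ` fixes a non-degenerate quadratic form. -/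
def BrauerHasIndicatorPlus {k : Type*} [Field k] (ℓ : ℕ) (θ : k →*₀ ℂ)
    (φ : LRegular G ℓ → ℂ) : Prop :=
  ∃ (n : ℕ) (ρ : G →* GL (Fin n) k) (S : Matrix (Fin n) (Fin n) k),
    brauerCharacter ℓ θ ρ = φ ∧ IsInvariantForm (RingHom.id k) ρ S

/-- The (finite) character field of a Brauer character, generated by the traces of the
representations affording it. -/
def brauerCharacterField {k : Type*} [Field k] (ℓ : ℕ) (θ : k →*₀ ℂ)
    (φ : LRegular G ℓ → ℂ) : Subfield k :=
  Subfield.closure {t | ∃ (n : ℕ) (ρ : G →* GL (Fin n) k) (g : G),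
    brauerCharacter ℓ θ ρ = φ ∧ traceChar ρ g = t}

/-- The class of `c` in `K^× / (K^×)²`, with `K` the character field of `φ`, is the orthogonal
discriminant of the Brauer character `φ`: for every field `L` (embedded into `k` by `ι`), every
representation `ρ : G → GL_n(L)` affording `φ` and every non-degenerate `ρ(G)`-invariant symmetric
bilinear form, the discriminant of the form is `c (L^×)²`. -/
def IsBrauerOrthogonalDiscriminant {k : Type} [Field k] (ℓ : ℕ) (θ : k →*₀ ℂ)
    (φ : LRegular G ℓ → ℂ) (c : k) : Prop :=
  c ∈ brauerCharacterField ℓ θ φ ∧ c ≠ 0 ∧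
  ∀ (L : Type) [Field L] (ι : L →+* k) (n : ℕ) (ρ : G →* GL (Fin n) L),
    brauerCharacter ℓ θ ((Matrix.GeneralLinearGroup.map ι).comp ρ) = φ →
    ∀ S : Matrix (Fin n) (Fin n) L, IsInvariantForm (RingHom.id L) ρ S →
      ∃ c' : L, ι c' = c ∧ DiscEq (RingHom.id L) S c'

end

end FaithfulDisc

/-!
Let `E` be an extraspecial group of type `2_+^{1+2d}`, generated by `d` commuting pairs
`(A i, B i)` of anticommuting involutions with common commutator the central involution `z`.
Such pairs are called a Pauli family here. Since `d ≥ 2`, the group `SO_m^+(p)` contains `E`, with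
`z = -1` (`exists_isPauliFamily_SOPlus`): the `m`-space is a tensor product of two symplectic planes
with an orthogonal space. On each plane a quaternion group `Q₈ ≤ SL₂(p)` acts, which exists because
`-1` is a sum of two squares modulo `p`; the central product of the two quaternion groups
contributes two pairs. The remaining `d - 2` pairs are bit flips and bit signs, acting on the third
factor. The resulting form is the split one up to signs and a permutation of the basis.

As `-1` is central in `G`, it acts as `-1` in every faithful irreducible representation
(`apply_eq_neg_one_of_isIrreducible`). The eigenvalues of an involution being determined by the
character values at it and at `1`, it acts as `-1` in every representation with the same (Brauer)
character, over whatever field (`apply_eq_neg_one_of_sum_roots_eq`). In such a representation the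
pairs of `E` are pairs of anticommuting involutions of the underlying space.

* The eigenspaces of `A 0` are interchanged by `B 0` and stable under the other pairs, so `2^d`
  divides the degree by induction (`IsPauliFamily.two_pow_dvd_finrank`).
* For an invariant form the two eigenspaces of `A 0` are orthogonal, and isometric via `B 0`. Hence
  the determinant is, up to norms, the square `t²` of the determinant `t` of one half. As `σ t = t`,
  this is the norm `t * σ t` (`det_eq_norm_of_anticomm`). The sign in the discriminant is trivial
  because `4` divides the degree.
-/

namespace FaithfulDisc

/-! ### Families of anticommuting pairs of involutions -/

/-- The pairs `(A i, B i)` consist of involutions with `A i * B i = z * (B i * A i)`, and distinct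
pairs commute elementwise. If `z` is central of order two, then the `A i` and `B i` generate an
extraspecial group of type `2_+^{1+2|J|}` with centre `⟨z⟩`. -/
structure IsPauliFamily {M J : Type*} [Monoid M] (z : M) (A B : J → M) : Prop where
  sq_left : ∀ i, A i * A i = 1
  sq_right : ∀ i, B i * B i = 1
  anticomm : ∀ i, A i * B i = z * (B i * A i)
  comm_left : ∀ i j, A i * A j = A j * A i
  comm_right : ∀ i j, B i * B j = B j * B i
  comm : ∀ i j, i ≠ j → A i * B j = B j * A i

namespace IsPauliFamily

theorem map {M N J : Type*} [Monoid M] [Monoid N] {z : M} {A B : J → M}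
    (h : IsPauliFamily z A B) (f : M →* N) :
    IsPauliFamily (f z) (fun i => f (A i)) (fun i => f (B i)) where
  sq_left i := by rw [← map_mul, h.sq_left, map_one]
  sq_right i := by rw [← map_mul, h.sq_right, map_one]
  anticomm i := by rw [← map_mul, h.anticomm, map_mul, map_mul]
  comm_left i j := by rw [← map_mul, h.comm_left, map_mul]
  comm_right i j := by rw [← map_mul, h.comm_right, map_mul]
  comm i j hij := by rw [← map_mul, h.comm i j hij, map_mul]

theorem comp_injective {M J J' : Type*} [Monoid M] {z : M} {A B : J → M}
    (h : IsPauliFamily z A B) {f : J' → J} (hf : Function.Injective f) :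
    IsPauliFamily z (A ∘ f) (B ∘ f) where
  sq_left _ := h.sq_left _
  sq_right _ := h.sq_right _
  anticomm _ := h.anticomm _
  comm_left _ _ := h.comm_left _ _
  comm_right _ _ := h.comm_right _ _
  comm _ _ hij := h.comm _ _ (hf.ne hij)

theorem of_map {M N J : Type*} [Monoid M] [Monoid N] {f : M →* N} (hf : Function.Injective f)
    {z : M} {A B : J → M} (h : IsPauliFamily (f z) (fun i => f (A i)) (fun i => f (B i))) :
    IsPauliFamily z A B where
  sq_left i := hf (by simpa using h.sq_left i)
  sq_right i := hf (by simpa using h.sq_right i)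
  anticomm i := hf (by simpa using h.anticomm i)
  comm_left i j := hf (by simpa using h.comm_left i j)
  comm_right i j := hf (by simpa using h.comm_right i j)
  comm i j hij := hf (by simpa using h.comm i j hij)

open scoped Kronecker in
/-- Pauli families on two spaces combine to one on their tensor product. -/
theorem kronecker {R I K J J' : Type*} [CommRing R] [Fintype I] [Fintype K] [DecidableEq I]
    [DecidableEq K] {A B : J → Matrix I I R} {A' B' : J' → Matrix K K R}
    (h : IsPauliFamily (-1) A B) (h' : IsPauliFamily (-1) A' B') :
    IsPauliFamily (-1 : Matrix (I × K) (I × K) R)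
      (Sum.elim (fun i => A i ⊗ₖ (1 : Matrix K K R)) (fun i => (1 : Matrix I I R) ⊗ₖ A' i))
      (Sum.elim (fun i => B i ⊗ₖ (1 : Matrix K K R)) (fun i => (1 : Matrix I I R) ⊗ₖ B' i)) where
  sq_left := by
    rintro (i | i) <;> simp [← Matrix.mul_kronecker_mul, h.sq_left, h'.sq_left]
  sq_right := by
    rintro (i | i) <;> simp [← Matrix.mul_kronecker_mul, h.sq_right, h'.sq_right]
  anticomm := by
    rintro (i | i) <;> simp only [Sum.elim_inl, Sum.elim_inr, ← Matrix.mul_kronecker_mul,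
      h.anticomm, h'.anticomm] <;> ext x y <;> simp
  comm_left := by
    rintro (i | i) (j | j)
    · simp [← Matrix.mul_kronecker_mul, h.comm_left i j]
    · simp [← Matrix.mul_kronecker_mul]
    · simp [← Matrix.mul_kronecker_mul]
    · simp [← Matrix.mul_kronecker_mul, h'.comm_left i j]
  comm_right := by
    rintro (i | i) (j | j)
    · simp [← Matrix.mul_kronecker_mul, h.comm_right i j]
    · simp [← Matrix.mul_kronecker_mul]
    · simp [← Matrix.mul_kronecker_mul]
    · simp [← Matrix.mul_kronecker_mul, h'.comm_right i j]
  comm := by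
    rintro (i | i) (j | j) hij
    · simp [← Matrix.mul_kronecker_mul, h.comm i j (fun e => hij (by rw [e]))]
    · simp [← Matrix.mul_kronecker_mul]
    · simp [← Matrix.mul_kronecker_mul]
    · simp [← Matrix.mul_kronecker_mul, h'.comm i j (fun e => hij (by rw [e]))]

end IsPauliFamily

/-! ### Bit flips and bit signs -/

section Bits

variable (R : Type*) [CommRing R] {k : ℕ} {Y : Type*} [DecidableEq Y]

/-- The permutation matrix flipping bit `i`. The factor `Y` is only a multiplicity space. -/
def bitFlip (i : Fin k) : Matrix ((Fin k → ZMod 2) × Y) ((Fin k → ZMod 2) × Y) R :=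
  Matrix.of fun v w => if w = (v.1 + Pi.single i 1, v.2) then 1 else 0

/-- The diagonal matrix with entry `-1` where bit `i` is set and `1` elsewhere. -/
def bitSign (i : Fin k) : Matrix ((Fin k → ZMod 2) × Y) ((Fin k → ZMod 2) × Y) R :=
  Matrix.diagonal fun v => if v.1 i = 0 then 1 else -1

variable {R}

theorem bitFlip_mul_apply [Fintype Y] (i : Fin k)
    (M : Matrix ((Fin k → ZMod 2) × Y) ((Fin k → ZMod 2) × Y) R)
    (v w : (Fin k → ZMod 2) × Y) :
    (bitFlip R i * M : Matrix _ _ R) v w = M (v.1 + Pi.single i 1, v.2) w := by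
  simp [bitFlip, Matrix.mul_apply]

theorem single_add_single_self (i : Fin k) :
    (Pi.single i 1 + Pi.single i 1 : Fin k → ZMod 2) = 0 := by
  rw [← Pi.single_add]
  simp [show (1 + 1 : ZMod 2) = 0 by decide]

theorem bitFlip_transpose (i : Fin k) :
    (bitFlip R i : Matrix ((Fin k → ZMod 2) × Y) _ R).transpose = bitFlip R i := by
  ext ⟨v, y⟩ ⟨w, x⟩
  have : (v = w + Pi.single i 1 ∧ y = x) ↔ (w = v + Pi.single i 1 ∧ x = y) := by
    constructor <;> rintro ⟨rfl, rfl⟩ <;> simp [add_assoc, single_add_single_self]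
  simp [bitFlip, this]

theorem bitSign_transpose (i : Fin k) :
    (bitSign R i : Matrix ((Fin k → ZMod 2) × Y) _ R).transpose = bitSign R i := by
  simp [bitSign]

theorem isPauliFamily_bits [Fintype Y] :
    IsPauliFamily (-1 : Matrix ((Fin k → ZMod 2) × Y) ((Fin k → ZMod 2) × Y) R)
      (bitFlip R) (bitSign R) where
  sq_left i := by
    ext v w
    rw [bitFlip_mul_apply]
    simp [bitFlip, add_assoc, single_add_single_self, Matrix.one_apply, eq_comm]
  sq_right i := by
    rw [bitSign, Matrix.diagonal_mul_diagonal, ← Matrix.diagonal_one]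
    congr 1
    funext v
    split_ifs <;> simp
  anticomm i := by
    ext v w
    have key : ∀ x : ZMod 2, (if x + 1 = 0 then 1 else -1 : R) = -(if x = 0 then 1 else -1) := by
      intro x
      obtain rfl | rfl : x = 0 ∨ x = 1 := by revert x; decide
      · simp
      · simp [show (1 + 1 : ZMod 2) = 0 by decide]
    rw [bitFlip_mul_apply, neg_one_mul, Matrix.neg_apply, bitSign, Matrix.diagonal_mul]
    by_cases h : w = (v.1 + Pi.single i 1, v.2)
    · simp [bitFlip, h, key]
    · simp [bitFlip, h, Matrix.diagonal_apply_ne' _ h]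
  comm_left i j := by
    ext v w
    rw [bitFlip_mul_apply, bitFlip_mul_apply]
    simp [bitFlip, add_assoc, add_comm (Pi.single i 1 : Fin k → ZMod 2)]
  comm_right i j := by
    simp [bitSign, Matrix.diagonal_mul_diagonal, mul_comm]
  comm i j hij := by
    ext v w
    rw [bitFlip_mul_apply, bitSign, Matrix.diagonal_mul]
    by_cases h : w = (v.1 + Pi.single i 1, v.2)
    · simp [bitFlip, h, Pi.single_eq_of_ne hij.symm]
    · simp [bitFlip, h, Matrix.diagonal_apply_ne' _ h]

end Bits

/-! ### Quaternion pairs on a hyperbolic space of dimension four -/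

section Quaternion

variable {R : Type*} [CommRing R]

/-- The standard symplectic form on the plane; it is at the same time a quaternion unit. -/
def symplecticPlane (R : Type*) [CommRing R] : Matrix (Fin 2) (Fin 2) R := !![0, 1; -1, 0]

/-- For `x² + y² = -1` this matrix is a quaternion unit anticommuting with `symplecticPlane`. -/
def quaternionUnit (x y : R) : Matrix (Fin 2) (Fin 2) R := !![x, y; y, -x]

theorem symplecticPlane_sq : symplecticPlane R * symplecticPlane R = -1 := by
  ext i j; fin_cases i <;> fin_cases j <;> simp [symplecticPlane]

theorem quaternionUnit_sq {x y : R} (h : x ^ 2 + y ^ 2 = -1) :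
    quaternionUnit x y * quaternionUnit x y = -1 := by
  ext i j
  fin_cases i <;> fin_cases j <;> simp [quaternionUnit]
  · linear_combination h
  · ring
  · ring
  · linear_combination h

theorem symplecticPlane_mul_quaternionUnit (x y : R) :
    symplecticPlane R * quaternionUnit x y = -(quaternionUnit x y * symplecticPlane R) := by
  ext i j; fin_cases i <;> fin_cases j <;> simp [symplecticPlane, quaternionUnit]

theorem det_symplecticPlane : (symplecticPlane R).det = 1 := by
  simp [symplecticPlane, Matrix.det_fin_two]

theorem det_quaternionUnit {x y : R} (h : x ^ 2 + y ^ 2 = -1) : (quaternionUnit x y).det = 1 := by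
  simp only [quaternionUnit, Matrix.det_fin_two_of]
  linear_combination -h

/-- In dimension two, matrices of determinant `1` are symplectic. -/
theorem transpose_mul_symplecticPlane_mul (M : Matrix (Fin 2) (Fin 2) R) (h : M.det = 1) :
    M.transpose * symplecticPlane R * M = symplecticPlane R := by
  rw [Matrix.det_fin_two] at h
  ext i j
  fin_cases i <;> fin_cases j <;> simp [symplecticPlane, Matrix.mul_apply, Fin.sum_univ_two]
  · ring
  · linear_combination h
  · linear_combination -h
  · ring

open scoped Kronecker

theorem neg_kronecker {I K : Type*} (A : Matrix I I R) (B : Matrix K K R) :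
    (-A) ⊗ₖ B = -(A ⊗ₖ B) := by
  ext x y; simp

theorem kronecker_neg {I K : Type*} (A : Matrix I I R) (B : Matrix K K R) :
    A ⊗ₖ (-B) = -(A ⊗ₖ B) := by
  ext x y; simp

/-- If `u`, `v` are anticommuting square roots of `-1`, with product `w`, then the two pairs
`(u ⊗ u, v ⊗ u)` and `(w ⊗ v, w ⊗ w)` show that the central product of two quaternion groups is
of type `2_+^{1+4}`. -/
theorem isPauliFamily_quaternion {I : Type*} [Fintype I] [DecidableEq I] {u v : Matrix I I R}
    (hu : u * u = -1) (hv : v * v = -1) (huv : u * v = -(v * u)) :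
    IsPauliFamily (-1 : Matrix (I × I) (I × I) R) ![u ⊗ₖ u, (u * v) ⊗ₖ v]
      ![v ⊗ₖ u, (u * v) ⊗ₖ (u * v)] := by
  have hv' (x : Matrix I I R) : v * (v * x) = -x := by rw [← mul_assoc, hv, neg_one_mul]
  have huv' (x : Matrix I I R) : u * (v * x) = -(v * (u * x)) := by
    rw [← mul_assoc, huv, neg_mul, mul_assoc]
  constructor <;>
    simp [Fin.forall_fin_two, ← Matrix.mul_kronecker_mul, mul_assoc, hu, hv, huv, hv', huv',
      neg_kronecker, kronecker_neg]

end Quaternion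

/-! ### A Pauli family in the special orthogonal group -/

/-- An indexing of `Fin m` by sign pairs and a label, for which reversal flips both signs. -/
theorem exists_equiv_rev {K : Type*} [Fintype K] {m : ℕ} (hm : 4 * Fintype.card K = m) :
    ∃ e : (Fin 2 × Fin 2) × K ≃ Fin m, ∀ x, (e x).rev = e ((x.1.1.rev, x.1.2.rev), x.2) := by
  have hc : Fintype.card (Fin 2 × K) = m / 2 := by simp; omega
  let g : Fin 2 × K ≃ Fin (m / 2) := Fintype.equivFinOfCardEq hc
  -- The first sign decides between the lower and the upper half of `Fin m`.
  let f : (Fin 2 × Fin 2) × K → Fin m := fun x =>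
    if x.1.1 = 0 then ⟨g (x.1.2, x.2), by omega⟩ else Fin.rev ⟨g (x.1.2.rev, x.2), by omega⟩
  have hf : Function.Injective f := by
    rintro ⟨⟨a, b⟩, c⟩ ⟨⟨a', b'⟩, c'⟩ h
    replace h := congrArg Fin.val h
    have h1 := (g (b, c)).2
    have h2 := (g (b', c')).2
    have h3 := (g (b.rev, c)).2
    have h4 := (g (b'.rev, c')).2
    obtain rfl | rfl : a = 0 ∨ a = 1 := by omega
    all_goals obtain rfl | rfl : a' = 0 ∨ a' = 1 := by omega
    all_goals simp only [f, if_true, one_ne_zero, if_false, Fin.val_rev] at h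
    · have : g (b, c) = g (b', c') := Fin.ext h
      simpa using this
    · omega
    · omega
    · have : g (b.rev, c) = g (b'.rev, c') := Fin.ext (by omega)
      simpa using this
  refine ⟨Equiv.ofBijective f ((Fintype.bijective_iff_injective_and_card f).2 ⟨hf, ?_⟩), ?_⟩
  · simp; omega
  · rintro ⟨⟨a, b⟩, c⟩
    obtain rfl | rfl : a = 0 ∨ a = 1 := by omega
    · simp [f]
    · simp [f]

section

open scoped Kronecker

variable {R : Type*} [CommRing R] {K : Type*} [Fintype K] [DecidableEq K]

/-- The sign change carrying the tensor product of two symplectic planes to the split form. -/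
def signChange (R K : Type*) [CommRing R] [DecidableEq K] :
    Matrix ((Fin 2 × Fin 2) × K) ((Fin 2 × Fin 2) × K) R :=
  Matrix.diagonal fun x => if x.1 = (1, 0) then -1 else 1

theorem signChange_mul_self : signChange R K * signChange R K = 1 := by
  rw [signChange, Matrix.diagonal_mul_diagonal, ← Matrix.diagonal_one]
  congr 1
  funext x
  split_ifs <;> simp

theorem splitForm_reindex {m : ℕ} (e : (Fin 2 × Fin 2) × K ≃ Fin m)
    (he : ∀ x, (e x).rev = e ((x.1.1.rev, x.1.2.rev), x.2)) :
    splitForm m R = Matrix.reindexAlgEquiv R R e (signChange R K *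
      ((symplecticPlane R ⊗ₖ symplecticPlane R) ⊗ₖ (1 : Matrix K K R)) * signChange R K) := by
  ext i j
  obtain ⟨x, rfl⟩ := e.surjective i
  obtain ⟨y, rfl⟩ := e.surjective j
  obtain ⟨⟨a, b⟩, c⟩ := x
  obtain ⟨⟨a', b'⟩, c'⟩ := y
  simp only [splitForm, Matrix.of_apply, he, e.injective.eq_iff, signChange,
    Matrix.coe_reindexAlgEquiv, Matrix.reindex_apply, Matrix.submatrix_apply,
    Equiv.symm_apply_apply, Matrix.mul_diagonal, Matrix.diagonal_mul, Matrix.kronecker_apply,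
    Matrix.one_apply]
  fin_cases a <;> fin_cases b <;> fin_cases a' <;> fin_cases b' <;>
    by_cases h : c = c' <;> simp [symplecticPlane, h, eq_comm]

/-- Change of basis from the tensor product of two symplectic planes, with multiplicity space
`R^K`, to the space carrying the split form. -/
def toSplit {m : ℕ} (e : (Fin 2 × Fin 2) × K ≃ Fin m) :
    Matrix ((Fin 2 × Fin 2) × K) ((Fin 2 × Fin 2) × K) R →* Matrix (Fin m) (Fin m) R where
  toFun M := Matrix.reindexAlgEquiv R R e (signChange R K * M * signChange R K)
  map_one' := by rw [mul_one, signChange_mul_self, map_one]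
  map_mul' M N := by
    rw [← map_mul]
    congr 1
    simp only [mul_assoc]
    rw [← mul_assoc (signChange R K) (signChange R K), signChange_mul_self, one_mul]

theorem toSplit_neg_one {m : ℕ} (e : (Fin 2 × Fin 2) × K ≃ Fin m) :
    toSplit e (-1 : Matrix _ _ R) = -1 := by
  change Matrix.reindexAlgEquiv R R e (signChange R K * (-1) * signChange R K) = -1
  rw [mul_neg, mul_one, neg_mul, signChange_mul_self, map_neg, map_one]

theorem det_toSplit {m : ℕ} (e : (Fin 2 × Fin 2) × K ≃ Fin m) (M : Matrix _ _ R) :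
    (toSplit e M).det = M.det := by
  change (Matrix.reindexAlgEquiv R R e (signChange R K * M * signChange R K)).det = _
  rw [Matrix.det_reindexAlgEquiv, Matrix.det_mul_right_comm, signChange_mul_self, one_mul]

theorem toSplit_transpose_mul_mul {m : ℕ} (e : (Fin 2 × Fin 2) × K ≃ Fin m)
    (he : ∀ x, (e x).rev = e ((x.1.1.rev, x.1.2.rev), x.2)) {M : Matrix _ _ R}
    (hM : M.transpose * ((symplecticPlane R ⊗ₖ symplecticPlane R) ⊗ₖ (1 : Matrix K K R)) * M =
      (symplecticPlane R ⊗ₖ symplecticPlane R) ⊗ₖ (1 : Matrix K K R)) :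
    (toSplit e M).transpose * splitForm m R * toSplit e M = splitForm m R := by
  have ht : (toSplit e M).transpose = toSplit e M.transpose := by
    change (Matrix.reindex e e (signChange R K * M * signChange R K)).transpose =
      Matrix.reindex e e (signChange R K * M.transpose * signChange R K)
    rw [Matrix.transpose_reindex]
    simp [signChange, Matrix.transpose_mul, mul_assoc]
  rw [ht, splitForm_reindex e he]
  change toSplit e M.transpose * toSplit e _ * toSplit e M = toSplit e _
  rw [← map_mul, ← map_mul, hM]

/-- For odd `p` this says that `SO_m^+(p)`, with `m = 2^d a` and `d ≥ 2`, contains an extraspecial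
group of type `2_+^{1+2d}` with central involution `-1`. -/
theorem exists_isPauliFamily_SOPlus (d a : ℕ) (hd : 2 ≤ d) (p : ℕ) [Fact p.Prime] :
    ∃ A B : Fin d → GL (Fin (2 ^ d * a)) (ZMod p), IsPauliFamily (-1) A B ∧
      (∀ i, A i ∈ SOPlus (2 ^ d * a) (ZMod p)) ∧ ∀ i, B i ∈ SOPlus (2 ^ d * a) (ZMod p) := by
  obtain ⟨k, rfl⟩ := Nat.exists_eq_add_of_le hd
  obtain ⟨x, y, hxy⟩ := ZMod.sq_add_sq p (-1)
  obtain ⟨e, he⟩ := exists_equiv_rev (K := (Fin k → ZMod 2) × Fin a) (m := 2 ^ (2 + k) * a)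
    (by simp [ZMod.card]; ring)
  let u := symplecticPlane (ZMod p)
  let v := quaternionUnit x y
  have hu : u.det = 1 := det_symplecticPlane
  have hv : v.det = 1 := det_quaternionUnit hxy
  have huv : (u * v).det = 1 := by rw [Matrix.det_mul, hu, hv, one_mul]
  have fam := (((isPauliFamily_quaternion symplecticPlane_sq (quaternionUnit_sq hxy)
    (symplecticPlane_mul_quaternionUnit x y)).kronecker
    (isPauliFamily_bits (R := ZMod p) (k := k) (Y := Fin a))).map (toSplit e)).comp_injective
    finSumFinEquiv.symm.injective
  rw [toSplit_neg_one] at fam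
  have quat : ∀ s t : Matrix (Fin 2) (Fin 2) (ZMod p), s.det = 1 → t.det = 1 →
      (toSplit e ((s ⊗ₖ t) ⊗ₖ 1)).transpose * splitForm _ _ * toSplit e ((s ⊗ₖ t) ⊗ₖ 1) =
        splitForm _ _ ∧ (toSplit e ((s ⊗ₖ t) ⊗ₖ 1)).det = 1 := by
    intro s t hs ht
    refine ⟨toSplit_transpose_mul_mul e he ?_, ?_⟩
    · simp only [← Matrix.kroneckerMap_transpose, ← Matrix.mul_kronecker_mul,
        transpose_mul_symplecticPlane_mul, hs, ht]
      simp
    · simp [det_toSplit, Matrix.det_kronecker, hs, ht]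
  have bits : ∀ s : Matrix ((Fin k → ZMod 2) × Fin a) ((Fin k → ZMod 2) × Fin a) (ZMod p),
      s.transpose = s → s * s = 1 →
      (toSplit e (1 ⊗ₖ s)).transpose * splitForm _ _ * toSplit e (1 ⊗ₖ s) =
        splitForm _ _ ∧ (toSplit e (1 ⊗ₖ s)).det = 1 := by
    intro s hs hs2
    refine ⟨toSplit_transpose_mul_mul e he ?_, ?_⟩
    · simp only [← Matrix.kroneckerMap_transpose, ← Matrix.mul_kronecker_mul, hs]
      simp [hs2]
      -- The Kronecker product with the identity of size four has determinant `s.det ^ 4`.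
    · have h2 : s.det ^ 2 = 1 := by rw [pow_two, ← Matrix.det_mul, hs2, Matrix.det_one]
      have h4 : s.det ^ (2 * 2) = 1 := by rw [pow_mul, h2, one_pow]
      simpa [det_toSplit, Matrix.det_kronecker] using h4
  have hbits := isPauliFamily_bits (R := ZMod p) (k := k) (Y := Fin a)
  refine ⟨fun i => ⟨_, _, fam.sq_left i, fam.sq_left i⟩, fun i => ⟨_, _, fam.sq_right i,
    fam.sq_right i⟩, IsPauliFamily.of_map (f := Units.coeHom _) Units.val_injective ?_, ?_, ?_⟩
  · simpa [Function.comp_def] using fam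
  · intro i
    obtain ⟨j, rfl⟩ := finSumFinEquiv.surjective i
    rcases j with j | j
    · fin_cases j
      · simpa [SOPlus] using quat u u hu hu
      · simpa [SOPlus] using quat (u * v) v huv hv
    · simpa [SOPlus] using bits _ (bitFlip_transpose j) (hbits.sq_left j)
  · intro i
    obtain ⟨j, rfl⟩ := finSumFinEquiv.surjective i
    rcases j with j | j
    · fin_cases j
      · simpa [SOPlus] using quat v u hv hu
      · simpa [SOPlus] using quat (u * v) (u * v) huv huv
    · simpa [SOPlus] using bits _ (bitSign_transpose j) (hbits.sq_right j)

end

/-! ### Dimensions and discriminants -/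

open Module in
/-- The eigenspace of an involution for the eigenvalue `1` has half the dimension, if an invertible
map anticommutes with the involution. -/
theorem finrank_eq_two_mul_of_anticomm {L V : Type*} [Field L] [AddCommGroup V] [Module L V]
    [FiniteDimensional L V] (h2 : (2 : L) ≠ 0) {A B : End L V} (hA : A * A = 1) (hB : B * B = 1)
    (hAB : A * B = -(B * A)) : finrank L V = 2 * finrank L (LinearMap.ker (A - 1)) := by
  have hA' (v : V) : A (A v) = v := by simpa using LinearMap.congr_fun hA v
  have hB' (v : V) : B (B v) = v := by simpa using LinearMap.congr_fun hB v
  have hAB' (v : V) : A (B v) = -B (A v) := by simpa using LinearMap.congr_fun hAB v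
  have hr : LinearMap.range (A - 1) = LinearMap.ker (A + 1) := by
    apply le_antisymm
    · rintro _ ⟨v, rfl⟩
      simp [hA']
    · intro v hv
      have hv' : A v = -v := by
        simpa [LinearMap.mem_ker, add_eq_zero_iff_eq_neg] using hv
      refine ⟨(-(2 : L)⁻¹) • v, ?_⟩
      rw [LinearMap.sub_apply, map_smul, hv', End.one_apply, smul_neg, neg_smul, neg_neg,
        sub_neg_eq_add, ← add_smul, ← two_mul, mul_inv_cancel₀ h2, one_smul]
  -- `B` interchanges the two eigenspaces of `A`.
  let e : V ≃ₗ[L] V := LinearEquiv.ofLinearMap B B hB hB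
  have he : (LinearMap.ker (A - 1)).map (e : V →ₗ[L] V) = LinearMap.ker (A + 1) := by
    ext v
    simp only [Submodule.mem_map, LinearMap.mem_ker, LinearMap.sub_apply, LinearMap.add_apply,
      End.one_apply, sub_eq_zero, add_eq_zero_iff_eq_neg]
    constructor
    · rintro ⟨w, hw, rfl⟩
      change A (B w) = -B w
      rw [hAB', hw]
    · intro hv
      refine ⟨B v, ?_, hB' v⟩
      rw [hAB', hv, map_neg, neg_neg]
  have := LinearMap.finrank_range_add_finrank_ker (A - 1)
  rw [hr, ← he, LinearEquiv.finrank_map_eq] at this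
  omega

open Module in
/-- A Pauli family of `d` pairs acts only on spaces whose dimension is a multiple of `2^d`: the
remaining pairs act on the eigenspace of the first involution, of half the dimension. -/
theorem IsPauliFamily.two_pow_dvd_finrank {L : Type*} [Field L] (h2 : (2 : L) ≠ 0) {d : ℕ} :
    ∀ {V : Type*} [AddCommGroup V] [Module L V] [FiniteDimensional L V] {A B : Fin d → End L V},
      IsPauliFamily (-1) A B → 2 ^ d ∣ finrank L V := by
  induction d with
  | zero => intros; simp
  | succ d ih =>
    intro V _ _ _ A B h
    rw [finrank_eq_two_mul_of_anticomm h2 (h.sq_left 0) (h.sq_right 0)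
      (by simpa using h.anticomm 0), pow_succ']
    refine mul_dvd_mul_left 2 ?_
    have stable : ∀ C : End L V, A 0 * C = C * A 0 →
        ∀ v ∈ LinearMap.ker (A 0 - 1), C v ∈ LinearMap.ker (A 0 - 1) := by
      intro C hC v hv
      have hC' : A 0 (C v) = C (A 0 v) := LinearMap.congr_fun hC v
      have hv' : A 0 v = v := by simpa [sub_eq_zero] using hv
      simp [hC', hv']
    have hA := fun i : Fin d => stable _ (h.comm_left 0 i.succ)
    have hB := fun i : Fin d => stable _ (h.comm 0 i.succ (Fin.succ_ne_zero i).symm)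
    refine ih (A := fun i => (A i.succ).restrict (hA i)) (B := fun i => (B i.succ).restrict (hB i))
      ⟨?_, ?_, ?_, ?_, ?_, ?_⟩
    · exact fun i => LinearMap.ext fun v => Subtype.ext (LinearMap.congr_fun (h.sq_left i.succ) v)
    · exact fun i => LinearMap.ext fun v => Subtype.ext (LinearMap.congr_fun (h.sq_right i.succ) v)
    · exact fun i => LinearMap.ext fun v => Subtype.ext (LinearMap.congr_fun (h.anticomm i.succ) v)
    · exact fun i j => LinearMap.ext fun v => Subtype.ext
        (LinearMap.congr_fun (h.comm_left i.succ j.succ) v)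
    · exact fun i j => LinearMap.ext fun v => Subtype.ext
        (LinearMap.congr_fun (h.comm_right i.succ j.succ) v)
    · exact fun i j hij => LinearMap.ext fun v => Subtype.ext
        (LinearMap.congr_fun (h.comm i.succ j.succ (by simpa using hij)) v)

theorem IsPauliFamily.two_pow_dvd_card {L : Type*} [Field L] (h2 : (2 : L) ≠ 0) {d n : ℕ}
    {A B : Fin d → Matrix (Fin n) (Fin n) L} (h : IsPauliFamily (-1) A B) : 2 ^ d ∣ n := by
  have h' := h.map (Matrix.toLinAlgEquiv' (R := L) (n := Fin n)).toAlgHom.toMonoidHom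
  have h1 : (Matrix.toLinAlgEquiv' (R := L) (n := Fin n)).toAlgHom.toMonoidHom (-1) = -1 := by
    change Matrix.toLinAlgEquiv' (R := L) (n := Fin n) (-1) = -1
    rw [map_neg, map_one]
  rw [h1] at h'
  simpa using h'.two_pow_dvd_finrank h2

/-- An anticommuting pair of isometric involutions splits the form into two isometric halves, the
eigenspaces of `A`, which `B` interchanges. Thus the determinant is the square of that of one half,
up to the norm of the determinant of the base change. -/
theorem det_eq_norm_of_anticomm {L : Type*} [Field L] (h2 : (2 : L) ≠ 0) {n : ℕ} {σ : L →+* L}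
    (hσ : ∀ x, σ (σ x) = x) {S A B : Matrix (Fin n) (Fin n) L} (hS : ∀ i j, S i j = σ (S j i)) (hS0 : S.det ≠ 0)
    (hA : A * A = 1) (hB : B * B = 1) (hAB : A * B = -(B * A))
    (hAS : A.transpose * S * A.map σ = S) (hBS : B.transpose * S * B.map σ = S) :
    ∃ x : L, x ≠ 0 ∧ S.det = x * σ x := by
  have hfin := finrank_eq_two_mul_of_anticomm h2
    (A := Matrix.toLinAlgEquiv' A) (B := Matrix.toLinAlgEquiv' B)
    (by rw [← map_mul, hA, map_one]) (by rw [← map_mul, hB, map_one])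
    (by rw [← map_mul, hAB, map_neg, map_mul])
  set W := LinearMap.ker (Matrix.toLinAlgEquiv' A - 1) with hW
  set h := Module.finrank L W
  have hn : n = h + h := by simpa [two_mul] using hfin
  let b := Module.finBasis L W
  -- The columns of `Q` form a basis of the eigenspace of `A`.
  let Q : Matrix (Fin n) (Fin h) L := Matrix.of fun i j => (b j : Fin n → L) i
  have hQcol (v : Fin h → L) : Q.mulVec v = ((∑ j, v j • b j : W) : Fin n → L) := by
    ext i
    simp [Q, Matrix.mulVec, dotProduct, mul_comm]
  have hQinj (v : Fin h → L) (hv : Q.mulVec v = 0) : v = 0 := by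
    rw [hQcol, Submodule.coe_eq_zero] at hv
    exact funext (Fintype.linearIndependent_iff.1 b.linearIndependent v hv)
  have hAQ : A * Q = Q := by
    ext i j
    have := (b j).2
    simp only [hW, LinearMap.mem_ker, LinearMap.sub_apply, Module.End.one_apply, sub_eq_zero,
      Matrix.toLinAlgEquiv'_apply] at this
    exact congrFun this i
  have hABQ : A * (B * Q) = -(B * Q) := by
    rw [← Matrix.mul_assoc, hAB, Matrix.neg_mul, Matrix.mul_assoc, hAQ]
  let P : Matrix (Fin n) (Fin h ⊕ Fin h) L := Matrix.fromCols Q (B * Q)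
  let e : Fin h ⊕ Fin h ≃ Fin n := finSumFinEquiv.trans (finCongr hn.symm)
  let P' : Matrix (Fin h ⊕ Fin h) (Fin h ⊕ Fin h) L := P.submatrix e id
  have hP' : P'.det ≠ 0 := by
    intro h0
    obtain ⟨v, hv0, hv⟩ := Matrix.exists_mulVec_eq_zero_iff.2 h0
    apply hv0
    have hPv : P.mulVec v = 0 := by
      ext i
      obtain ⟨j, rfl⟩ := e.surjective i
      exact congrFun hv j
    have hsum : Q.mulVec (v ∘ Sum.inl) + (B * Q).mulVec (v ∘ Sum.inr) = 0 := by
      rwa [Matrix.fromCols_mulVec] at hPv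
    have hdiff : Q.mulVec (v ∘ Sum.inl) - (B * Q).mulVec (v ∘ Sum.inr) = 0 := by
      have := congrArg A.mulVec hsum
      rwa [Matrix.mulVec_add, Matrix.mulVec_mulVec, Matrix.mulVec_mulVec, hAQ, hABQ,
        Matrix.neg_mulVec, Matrix.mulVec_zero, ← sub_eq_add_neg] at this
    have hl : Q.mulVec (v ∘ Sum.inl) = 0 := by
      have : (2 : L) • Q.mulVec (v ∘ Sum.inl) = 0 := by
        rw [two_smul]
        linear_combination hsum + hdiff
      exact (smul_eq_zero.1 this).resolve_left h2
    have hr : Q.mulVec (v ∘ Sum.inr) = 0 := by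
      have : B.mulVec ((B * Q).mulVec (v ∘ Sum.inr)) = 0 := by
        rw [hl, zero_add] at hsum
        rw [hsum, Matrix.mulVec_zero]
      rwa [Matrix.mulVec_mulVec, ← Matrix.mul_assoc, hB, Matrix.one_mul] at this
    ext (i | i)
    · exact congrFun (hQinj _ hl) i
    · exact congrFun (hQinj _ hr) i
  set T := Q.transpose * S * Q.map σ with hT
  have hBQσ : (B * Q).map σ = B.map σ * Q.map σ := Matrix.map_mul
  have hAQσ : A.map σ * Q.map σ = Q.map σ := by rw [← Matrix.map_mul, hAQ]
  have hABQσ : A.map σ * (B * Q).map σ = -(B * Q).map σ := by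
    rw [← Matrix.map_mul, hABQ, Matrix.map_neg _ (map_neg σ)]
  -- The two eigenspaces are orthogonal, as `A` is an isometry.
  have horth {X Y : Matrix (Fin n) (Fin h) L} {c : L} (hc : c * c = 1) (hX : A * X = c • X)
      (hY : A.map σ * Y = -(c • Y)) : X.transpose * S * Y = 0 := by
    have h1 : X.transpose * S * Y = -(X.transpose * S * Y) := by
      calc X.transpose * S * Y = X.transpose * (A.transpose * S * A.map σ) * Y := by rw [hAS]
        _ = (A * X).transpose * S * (A.map σ * Y) := by
          simp only [Matrix.transpose_mul, Matrix.mul_assoc]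
        _ = _ := by simp [hX, hY, smul_smul, hc]
    have h3 : (2 : L) • (X.transpose * S * Y) = 0 := by
      rw [two_smul]
      nth_rw 2 [h1]
      exact add_neg_cancel _
    exact (smul_eq_zero.1 h3).resolve_left h2
  have h12 : Q.transpose * S * (B * Q).map σ = 0 :=
    horth (c := 1) (by ring) (by rw [hAQ, one_smul]) (by rw [hABQσ, one_smul])
  have h21 : (B * Q).transpose * S * Q.map σ = 0 :=
    horth (c := -1) (by ring) (by rw [hABQ, neg_smul, one_smul])
      (by rw [hAQσ, neg_smul, one_smul, neg_neg])
  have hBT : (B * Q).transpose * S * (B * Q).map σ = T := by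
    rw [hBQσ, hT]
    nth_rw 2 [← hBS]
    simp only [Matrix.transpose_mul, Matrix.mul_assoc]
  have hPσ : P.map σ = Matrix.fromCols (Q.map σ) ((B * Q).map σ) := by
    ext i (j | j) <;> rfl
  have hgram : P.transpose * S * P.map σ = Matrix.fromBlocks T 0 0 T := by
    rw [hPσ, Matrix.transpose_fromCols, Matrix.fromRows_mul, Matrix.fromRows_mul_fromCols, hBT,
      h12, h21]
  have hgram' : P'.transpose * S.submatrix e e * P'.map σ = P.transpose * S * P.map σ := by
    change P.transpose.submatrix id e * S.submatrix e e * (P.map σ).submatrix e id = _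
    rw [Matrix.submatrix_mul_equiv, Matrix.submatrix_mul_equiv, Matrix.submatrix_id_id]
  have hdet : P'.det * S.det * σ P'.det = T.det * T.det := by
    have := congrArg Matrix.det (hgram'.trans hgram)
    rwa [Matrix.det_mul, Matrix.det_mul, Matrix.det_transpose, Matrix.det_submatrix_equiv_self,
      Matrix.det_fromBlocks_zero₂₁, ← RingHom.mapMatrix_apply, ← RingHom.map_det] at this
  have hTσ : σ T.det = T.det := by
    have hTT : (T.map σ).transpose = T := by
      have hSS : (S.map σ).transpose = S := by
        ext i j
        exact (hS i j).symm
      have hQQ : (Q.map σ).map σ = Q := by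
        ext i j
        exact hσ _
      rw [hT, Matrix.map_mul, Matrix.map_mul, hQQ, Matrix.transpose_mul, Matrix.transpose_mul, hSS,
        Matrix.mul_assoc]
      rfl
    rw [RingHom.map_det, RingHom.mapMatrix_apply, ← Matrix.det_transpose, hTT]
  have hσP : σ P'.det ≠ 0 := (map_ne_zero σ).2 hP'
  have hx : S.det = T.det / P'.det * σ (T.det / P'.det) := by
    rw [map_div₀, hTσ]
    field_simp
    linear_combination hdet
  refine ⟨_, ?_, hx⟩
  intro h0
  rw [h0, zero_mul] at hx
  exact hS0 hx

/-! ### The central involution in representations -/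

section

variable {G : Type*} [Group G]

theorem apply_eq_neg_one_of_isIrreducible {L : Type*} [Field L] {n : ℕ} {ρ : G →* GL (Fin n) L}
    (hirr : (toRepresentation ρ).IsIrreducible) (hinj : Function.Injective ρ) {z : G}
    (hz2 : z * z = 1) (hz1 : z ≠ 1) (hz : ∀ g, z * g = g * z) :
    (ρ z : Matrix (Fin n) (Fin n) L) = -1 := by
  set M : Matrix (Fin n) (Fin n) L := (ρ z).val
  have hM : M * M = 1 := by rw [← Units.val_mul, ← map_mul, hz2, map_one, Units.val_one]
  let W : Subrepresentation (toRepresentation ρ) :=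
    { toSubmodule := LinearMap.ker (Matrix.toLin' (M - 1))
      apply_mem_toSubmodule := by
        intro g v hv
        have hv' : M.mulVec v = v := by
          simpa [Matrix.sub_mulVec, sub_eq_zero] using hv
        have hg : M * ρ g = ρ g * M := by
          rw [← Units.val_mul, ← map_mul, hz, map_mul, Units.val_mul]
        change (M - 1).mulVec ((ρ g : Matrix (Fin n) (Fin n) L).mulVec v) = 0
        rw [Matrix.mulVec_mulVec, Matrix.sub_mul, hg, Matrix.one_mul, Matrix.sub_mulVec,
          ← Matrix.mulVec_mulVec, hv', sub_self] }
  rcases eq_bot_or_eq_top W with h | h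
  · have hker : LinearMap.ker (Matrix.toLin' (M - 1)) = ⊥ :=
      congrArg Subrepresentation.toSubmodule h
    have hprod : (M - 1) * (M + 1) = 0 := by
      rw [sub_mul, mul_add, hM]
      simp [add_comm]
    rw [← add_eq_zero_iff_eq_neg, Matrix.ext_iff_mulVec]
    intro v
    rw [Matrix.zero_mulVec]
    apply LinearMap.ker_eq_bot'.1 hker
    rw [Matrix.toLin'_apply, Matrix.mulVec_mulVec, hprod, Matrix.zero_mulVec]
  · have hker : LinearMap.ker (Matrix.toLin' (M - 1)) = ⊤ :=
      congrArg Subrepresentation.toSubmodule h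
    rw [LinearMap.ker_eq_top, LinearEquiv.map_eq_zero_iff] at hker
    have hM1 : M = 1 := sub_eq_zero.1 hker
    exact absurd (hinj (Units.ext (by rw [map_one]; exact hM1))) hz1

theorem sum_eq_neg_card_imp {s : Multiset ℂ} (hs : ∀ x ∈ s, x = 1 ∨ x = -1)
    (hsum : s.sum = -(s.card : ℂ)) : ∀ x ∈ s, x = -1 := by
  have key : ∀ s : Multiset ℂ, (∀ x ∈ s, x = 1 ∨ x = -1) →
      ∃ c : ℕ, s.sum = -(s.card : ℂ) + 2 * c ∧ (c = 0 → ∀ x ∈ s, x = -1) := by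
    intro s
    induction s using Multiset.induction_on with
    | empty => exact fun _ => ⟨0, by simp⟩
    | cons a s ih =>
      intro h
      obtain ⟨c, hc, hc0⟩ := ih fun x hx => h x (Multiset.mem_cons_of_mem hx)
      rcases h a (Multiset.mem_cons_self a s) with rfl | rfl
      · refine ⟨c + 1, ?_, by simp⟩
        rw [Multiset.sum_cons, hc, Multiset.card_cons]
        push_cast
        ring
      · refine ⟨c, ?_, fun h0 => by simpa using hc0 h0⟩
        rw [Multiset.sum_cons, hc, Multiset.card_cons]
        push_cast
        ring
  obtain ⟨c, hc, hc0⟩ := key s hs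
  refine hc0 ?_
  rw [hsum] at hc
  simpa using hc

theorem sq_eq_one_of_mem_roots_charpoly {k : Type*} [Field k] {n : ℕ}
    {M : Matrix (Fin n) (Fin n) k} (hM : M * M = 1) {r : k} (hr : r ∈ M.charpoly.roots) :
    r * r = 1 := by
  have h0 : (Matrix.scalar (Fin n) r - M).det = 0 := by
    rw [← Matrix.eval_charpoly]
    exact (Polynomial.mem_roots'.1 hr).2
  have h1 : (Matrix.scalar (Fin n) r - M) * (Matrix.scalar (Fin n) r + M) =
      Matrix.scalar (Fin n) (r * r - 1) := by
    have hc : Matrix.scalar (Fin n) r * M = M * Matrix.scalar (Fin n) r :=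
      (Matrix.scalar_commute r (fun _ => Commute.all _ _) M).eq
    rw [sub_mul, mul_add, mul_add, hM, hc, map_sub, map_mul, map_one]
    abel
  have h2 := congrArg Matrix.det h1
  rw [Matrix.det_mul, h0, zero_mul, Matrix.scalar_apply, Matrix.det_diagonal] at h2
  simp only [Finset.prod_const] at h2
  exact sub_eq_zero.1 (eq_zero_of_pow_eq_zero h2.symm)

/-- An involution whose lifted eigenvalues sum to minus the degree is `-1`. -/
theorem eq_neg_one_of_sum_roots {k : Type*} [Field k] [IsAlgClosed k] {θ : k →*₀ ℂ}
    {n : ℕ} {M : Matrix (Fin n) (Fin n) k} (hM : M * M = 1)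
    (hsum : (M.charpoly.roots.map θ).sum = -(n : ℂ)) : M = -1 := by
  have hcard : M.charpoly.roots.card = n := by
    rw [← (IsAlgClosed.splits M.charpoly).natDegree_eq_card_roots, Matrix.charpoly_natDegree_eq_dim,
      Fintype.card_fin]
  have hroots : ∀ x ∈ M.charpoly.roots.map θ, x = -1 := by
    refine sum_eq_neg_card_imp ?_ (by rw [hsum, Multiset.card_map, hcard])
    intro x hx
    obtain ⟨r, hr, rfl⟩ := Multiset.mem_map.1 hx
    rw [← mul_self_eq_one_iff, ← map_mul, sq_eq_one_of_mem_roots_charpoly hM hr, map_one]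
  have hdet : (1 - M).det ≠ 0 := by
    intro h0
    have h1 : (1 : k) ∈ M.charpoly.roots := by
      rw [Polynomial.mem_roots M.charpoly_monic.ne_zero, Polynomial.IsRoot.def,
        Matrix.eval_charpoly, map_one, h0]
    have := hroots _ (Multiset.mem_map_of_mem θ h1)
    rw [map_one] at this
    norm_num at this
  have hprod : (1 - M) * (M + 1) = 0 := by
    rw [sub_mul, mul_add M, hM]
    simp [add_comm]
  rw [← add_eq_zero_iff_eq_neg]
  have hu : IsUnit (1 - M) := (Matrix.isUnit_iff_isUnit_det _).2 (isUnit_iff_ne_zero.2 hdet)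
  exact hu.mul_right_eq_zero.1 hprod

theorem charpoly_roots_scalar {k : Type*} [Field k] {n : ℕ} (c : k) :
    (Matrix.scalar (Fin n) c).charpoly.roots = Multiset.replicate n c := by
  rw [Matrix.scalar_apply, Matrix.charpoly_diagonal, Finset.prod_const, Polynomial.roots_pow,
    Polynomial.roots_X_sub_C]
  simp [Multiset.nsmul_singleton]

/-- A Pauli family with central element acting as `-1` forces `2^d` to divide the degree, and all
invariant forms to have trivial discriminant. -/
theorem dvd_and_discEq_one {L : Type*} [Field L] (h2 : (2 : L) ≠ 0) {n d : ℕ} (hd : 2 ≤ d)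
    {z : G} {A B : Fin d → G} (h : IsPauliFamily z A B) {ρ : G →* GL (Fin n) L}
    (hz : (ρ z : Matrix (Fin n) (Fin n) L) = -1) :
    2 ^ d ∣ n ∧ ∀ (σ : L →+* L), (∀ x, σ (σ x) = x) → ∀ S, IsInvariantForm σ ρ S →
      DiscEq σ S 1 := by
  have fam := h.map ((Units.coeHom (Matrix (Fin n) (Fin n) L)).comp ρ)
  have hz' : ((Units.coeHom (Matrix (Fin n) (Fin n) L)).comp ρ) z = -1 := hz
  rw [hz'] at fam
  have hn := fam.two_pow_dvd_card h2
  refine ⟨hn, fun σ hσ S hS => ?_⟩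
  let i : Fin d := ⟨0, by omega⟩
  obtain ⟨x, hx, hdet⟩ := det_eq_norm_of_anticomm h2 hσ hS.hermitian hS.nondegenerate
    (fam.sq_left i) (fam.sq_right i) (by simpa using fam.anticomm i) (hS.invariant (A i))
    (hS.invariant (B i))
  refine ⟨x, hx, ?_⟩
  -- The sign is trivial, as the degree is a multiple of four.
  obtain ⟨c, rfl⟩ : 4 ∣ n := (pow_dvd_pow 2 hd).trans hn
  have heven : Even ((4 * c).choose 2) := by
    rw [Nat.choose_two_right, show 4 * c * (4 * c - 1) = 2 * (2 * (c * (4 * c - 1))) by ring,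
      Nat.mul_div_cancel_left _ two_pos]
    exact even_two_mul _
  rw [heven.neg_one_pow, one_mul, one_mul, hdet]

/-- If the extension of a representation to an algebraically closed field has the same lifted
eigenvalue sums at `1` and at an involution `z` as a representation in which `z` acts as `-1`, then
`z` acts as `-1` in it as well. -/
theorem apply_eq_neg_one_of_sum_roots_eq {L k : Type*} [Field L] [Field k] [IsAlgClosed k]
    {θ : k →*₀ ℂ} (hθ : θ (-1) = -1) (ι : L →+* k) {n₀ n : ℕ} {ρ₀ : G →* GL (Fin n₀) k}
    {ρ : G →* GL (Fin n) L} {z : G} (hz2 : z * z = 1)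
    (hz : (ρ₀ z : Matrix (Fin n₀) (Fin n₀) k) = -1)
    (h : ∀ g ∈ ({1, z} : Set G),
      ((((ρ g : Matrix (Fin n) (Fin n) L).map ι).charpoly.roots.map θ).sum =
        ((ρ₀ g : Matrix (Fin n₀) (Fin n₀) k).charpoly.roots.map θ).sum)) :
    (ρ z : Matrix (Fin n) (Fin n) L) = -1 := by
  have hone (m : ℕ) : ((1 : Matrix (Fin m) (Fin m) k).charpoly.roots.map θ).sum = m := by
    rw [← map_one (Matrix.scalar (Fin m)), charpoly_roots_scalar]
    simp
  have hneg (m : ℕ) : ((-1 : Matrix (Fin m) (Fin m) k).charpoly.roots.map θ).sum = -m := by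
    rw [← map_one (Matrix.scalar (Fin m)), ← map_neg, charpoly_roots_scalar]
    simp [hθ]
  have h1 := h 1 (by simp)
  have hz' := h z (by simp)
  rw [map_one, map_one, Units.val_one, Units.val_one,
    Matrix.map_one ι (map_zero ι) (map_one ι), hone, hone] at h1
  rw [hz, hneg, ← h1] at hz'
  have hM : (ρ z : Matrix (Fin n) (Fin n) L).map ι * (ρ z : Matrix (Fin n) (Fin n) L).map ι
      = 1 := by
    rw [← Matrix.map_mul, ← Units.val_mul, ← map_mul, hz2, map_one, Units.val_one,
      Matrix.map_one ι (map_zero ι) (map_one ι)]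
  have := eq_neg_one_of_sum_roots hM hz'
  apply Matrix.map_injective ι.injective
  change (ρ z : Matrix (Fin n) (Fin n) L).map ι = (-1 : Matrix (Fin n) (Fin n) L).map ι
  rw [this, Matrix.map_neg _ (map_neg ι), Matrix.map_one ι (map_zero ι) (map_one ι)]

end

/-! ### The family inside a group containing `SO_m^+(p)` -/

theorem two_ne_zero_of_ringHom {p : ℕ} [Fact p.Prime] (hp : Odd p) {F : Type*} [Field F]
    (f : ZMod p →+* F) : (2 : F) ≠ 0 := by
  have h : (2 : ZMod p) ≠ 0 := by
    intro h0
    have h1 : ((2 : ℕ) : ZMod p) = 0 := by exact_mod_cast h0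
    rw [ZMod.natCast_eq_zero_iff, Nat.dvd_prime Nat.prime_two] at h1
    rcases h1 with rfl | rfl
    · exact absurd (Fact.out : Nat.Prime 1) Nat.not_prime_one
    · exact absurd hp (by decide)
  rw [← map_ofNat f 2]
  exact (map_ne_zero f).2 h

/-- A group containing a conjugate of `SO_m^+(p)` contains a Pauli family whose central involution
is the scalar `-1`, and thus central in the whole group. -/
theorem exists_isPauliFamily_of_le (d a : ℕ) (hd : 2 ≤ d) (ha : 1 ≤ a) (p : ℕ) [Fact p.Prime]
    (hp : Odd p) (F : Type*) [Field F] [Algebra (ZMod p) F]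
    (G : Subgroup (GL (Fin (2 ^ d * a)) F)) (T : GL (Fin (2 ^ d * a)) F)
    (hG : ((SOPlus (2 ^ d * a) (ZMod p)).map
        (Matrix.GeneralLinearGroup.map (algebraMap (ZMod p) F))).map
        (MulAut.conj T).toMonoidHom ≤ G) :
    ∃ (z : G) (A B : Fin d → G), IsPauliFamily z A B ∧ z * z = 1 ∧ z ≠ 1 ∧
      ∀ g, z * g = g * z := by
  obtain ⟨A, B, h, hA, hB⟩ := exists_isPauliFamily_SOPlus d a hd p
  let f : GL (Fin (2 ^ d * a)) (ZMod p) →* GL (Fin (2 ^ d * a)) F :=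
    (MulAut.conj T).toMonoidHom.comp (Matrix.GeneralLinearGroup.map (algebraMap (ZMod p) F))
  have hmem : ∀ M ∈ SOPlus (2 ^ d * a) (ZMod p), f M ∈ G := fun M hM =>
    hG (Subgroup.mem_map_of_mem _ (Subgroup.mem_map_of_mem _ hM))
  have hmap : Matrix.GeneralLinearGroup.map (algebraMap (ZMod p) F)
      (-1 : GL (Fin (2 ^ d * a)) (ZMod p)) = -1 := by
    apply Units.ext
    change (-1 : Matrix (Fin (2 ^ d * a)) (Fin (2 ^ d * a)) (ZMod p)).map _ = -1
    rw [Matrix.map_neg _ (map_neg _), Matrix.map_one _ (map_zero _) (map_one _)]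
  have hf : f (-1) = -1 := by
    change T * Matrix.GeneralLinearGroup.map (algebraMap (ZMod p) F)
      (-1 : GL (Fin (2 ^ d * a)) (ZMod p)) * T⁻¹ = -1
    rw [hmap]
    simp
  have hfam := h.map f
  rw [hf] at hfam
  let i : Fin d := ⟨0, by omega⟩
  have hneg : (-1 : GL (Fin (2 ^ d * a)) F) ∈ G := by
    rw [eq_mul_inv_iff_mul_eq.2 (hfam.anticomm i).symm]
    exact G.mul_mem (G.mul_mem (hmem _ (hA i)) (hmem _ (hB i)))
      (G.inv_mem (G.mul_mem (hmem _ (hB i)) (hmem _ (hA i))))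
  refine ⟨⟨-1, hneg⟩, fun i => ⟨f (A i), hmem _ (hA i)⟩, fun i => ⟨f (B i), hmem _ (hB i)⟩,
    IsPauliFamily.of_map (f := G.subtype) G.subtype_injective hfam, ?_, ?_, ?_⟩
  · exact Subtype.ext (by simp)
  · intro h0
    have h1 : (-1 : Matrix (Fin (2 ^ d * a)) (Fin (2 ^ d * a)) F) = 1 :=
      congrArg Units.val (congrArg Subtype.val h0)
    have hpos : 0 < 2 ^ d * a := by positivity
    have h2 := congrFun (congrFun h1 ⟨0, hpos⟩) ⟨0, hpos⟩
    simp only [Matrix.neg_apply, Matrix.one_apply_eq] at h2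
    exact two_ne_zero_of_ringHom hp (algebraMap (ZMod p) F) (by linear_combination -h2)
  · exact fun g => Subtype.ext (by simp)

end FaithfulDisc

/-! ### Degrees and discriminants of faithful characters -/

open FaithfulDisc in
theorem mainTheorem9
    (d a : ℕ) (hd : 2 ≤ d) (ha : 1 ≤ a) (p : ℕ) [Fact p.Prime] (hp : Odd p)
    (F : Type) [Field F] [Finite F] [Algebra (ZMod p) F]
    (G : Subgroup (GL (Fin (2 ^ d * a)) F))
    (T : GL (Fin (2 ^ d * a)) F)
    (hG : ((FaithfulDisc.SOPlus (2 ^ d * a) (ZMod p)).map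
        (Matrix.GeneralLinearGroup.map (algebraMap (ZMod p) F))).map
        (MulAut.conj T).toMonoidHom ≤ G) :
    (∀ χ : G → ℂ, FaithfulDisc.IsFaithfulIrreducibleCharacter χ →
      (∃ b : ℕ, χ 1 = ((2 ^ d * b : ℕ) : ℂ)) ∧
      (FaithfulDisc.HasIndicatorPlus χ → FaithfulDisc.IsOrthogonalDiscriminant χ 1) ∧
      (FaithfulDisc.HasIndicatorO χ → FaithfulDisc.IsUnitaryDiscriminant χ 1)) ∧
    (∀ (ℓ : ℕ), ℓ.Prime → Odd ℓ →
      ∀ (k : Type) [Field k] [IsAlgClosed k] [CharP k ℓ] (θ : k →*₀ ℂ),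
      FaithfulDisc.IsRootOfUnityLift θ →
      ∀ φ : FaithfulDisc.LRegular G ℓ → ℂ,
      FaithfulDisc.IsFaithfulIrreducibleBrauerCharacter ℓ θ φ →
      (∃ b : ℕ, φ (FaithfulDisc.LRegular.id G ℓ) = ((2 ^ d * b : ℕ) : ℂ)) ∧
      (FaithfulDisc.BrauerHasIndicatorPlus ℓ θ φ →
        FaithfulDisc.IsBrauerOrthogonalDiscriminant ℓ θ φ 1)) := by
  obtain ⟨z, A, B, fam, hz2, hz1, hz⟩ := exists_isPauliFamily_of_le d a hd ha p hp F G T hG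
  constructor
  · rintro χ ⟨n₀, ρ₀, hirr, hinj, rfl⟩
    have hz₀ := apply_eq_neg_one_of_isIrreducible hirr hinj hz2 hz1 hz
    -- Over `ℂ` the trace is the sum of the eigenvalues, so the lift can be taken to be the identity.
    have key : ∀ (L : Type) [Field L] (ι : L →+* ℂ) (n : ℕ) (ρ : G →* GL (Fin n) L),
        (∀ g, ι (traceChar ρ g) = traceChar ρ₀ g) →
        ∀ σ : L →+* L, (∀ x, σ (σ x) = x) → ∀ S, IsInvariantForm σ ρ S → DiscEq σ S 1 := by
      intro L _ ι n ρ hρ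
      have h2 : (2 : L) ≠ 0 := fun h0 =>
        two_ne_zero (α := ℂ) (by rw [← map_ofNat ι 2, h0, map_zero])
      refine (dvd_and_discEq_one h2 hd fam (apply_eq_neg_one_of_sum_roots_eq
        (θ := MonoidWithZeroHom.id ℂ) rfl ι hz2 hz₀ fun g _ => ?_)).2
      have := hρ g
      rw [traceChar, traceChar, AddMonoidHom.map_trace ι] at this
      simpa [← Matrix.trace_eq_sum_roots_charpoly] using this
    refine ⟨?_, fun _ => ⟨one_mem _, one_ne_zero, ?_⟩,
      fun _ => ⟨one_mem _, map_one _, one_ne_zero, ?_⟩⟩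
    · obtain ⟨b, hb⟩ := (dvd_and_discEq_one two_ne_zero hd fam hz₀).1
      refine ⟨b, ?_⟩
      rw [← hb]
      simp [traceChar]
    · intro L _ ι n ρ hρ S hS
      exact ⟨1, map_one ι, key L ι n ρ hρ _ (fun _ => rfl) S hS⟩
    · intro M _ ι σ hσ _ n ρ hρ S hS
      exact ⟨1, map_one ι, key M ι n ρ hρ σ hσ S hS⟩
  · rintro ℓ hℓ hodd k _ _ _ θ hθ φ ⟨n₀, ρ₀, hirr, hinj, rfl⟩
    have : Fact ℓ.Prime := ⟨hℓ⟩
    have h2 : (2 : k) ≠ 0 := two_ne_zero_of_ringHom hodd (ZMod.castHom dvd_rfl k)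
    have hz₀ := apply_eq_neg_one_of_isIrreducible hirr hinj hz2 hz1 hz
    have hθ' : θ (-1) = -1 := by
      have hsq : θ (-1) * θ (-1) = 1 := by rw [← map_mul]; simp
      refine (mul_self_eq_one_iff.1 hsq).resolve_left fun h1 => h2 ?_
      have := hθ (-1) 2 two_ne_zero (by simp) h1
      linear_combination -this
    have hreg : (orderOf z).Coprime ℓ :=
      Nat.Coprime.coprime_dvd_left (orderOf_dvd_of_pow_eq_one (by rw [pow_two, hz2]))
        (Nat.coprime_two_left.2 hodd)
    refine ⟨?_, fun _ => ⟨one_mem _, one_ne_zero, ?_⟩⟩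
    · obtain ⟨b, hb⟩ := (dvd_and_discEq_one h2 hd fam hz₀).1
      refine ⟨b, ?_⟩
      rw [← hb, brauerCharacter, LRegular.id, map_one, Units.val_one,
        ← map_one (Matrix.scalar (Fin n₀)), charpoly_roots_scalar]
      simp
    · intro L _ ι n ρ hρ S hS
      have h2L : (2 : L) ≠ 0 := fun h0 => h2 (by rw [← map_ofNat ι 2, h0, map_zero])
      refine ⟨1, map_one ι, (dvd_and_discEq_one h2L hd fam (apply_eq_neg_one_of_sum_roots_eq hθ' ι
        hz2 hz₀ ?_)).2 _ (fun _ => rfl) S hS⟩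
      rintro g (rfl | rfl)
      · exact congrFun hρ (LRegular.id G ℓ)
      · exact congrFun hρ ⟨g, hreg⟩
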